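/- Let $k$ be a field, $G$ a finite group, and $\alpha\in Z^2(G,k^\times)$ a 2-cocycle ($G$ acting trivially on $k^\times$), i.e. $\alpha(x,yz)\alpha(y,z)=\alpha(xy,z)\alpha(x,y)$. Let $k_\alpha G$ be the twisted group algebra, with $k$-basis $\{\bar g: g\in G\}$ and multiplication $\bar g\cdot\bar h=\alpha(g,h)\,\overline{gh}$. Let $C^n(k_\alpha G,k_\alpha G)=\operatorname{Hom}_k((k_\alpha G)^{\otimes n},k_\alpha G)$, with the Hochschild differential $\delta^n$, be the Hochschild cochain complex; its cohomology is $\operatorname{HH}^n(k_\alpha G)$. For $x\in G$ let $k\bar x$ be the one-dimensional $kC_G(x)$-module with $h\bar x=\alpha(h,x)\alpha(x,h)^{-1}\bar x$ for $h\in C_G(x)$. For a group $H$ and a $kH$-module $A$, let $C^n(H,A)=\operatorname{Maps}(H^{n},A)$, with the usual differential $\partial^n$, be the complex of inhomogeneous cochains; its cohomology is $\operatorname{H}^n(H,A)$. If $x\in Z(G)$, then $C_G(x)=G$ and $k\bar x$ is regarded as a $kG$-module. For $x\in G$ and $n\ge 0$ define $$\pi^n_{G,x,\alpha}:C^n(k_\alpha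 G,k_\alpha G)\to C^n(C_G(x),k\bar x),\qquad \pi^n_{G,x,\alpha}(\varphi)(h_1,\dots,h_n)=a\,\bar x,$$ where $a\in k$ is the coefficient of $\bar x$ in $\varphi(\overline{h_1}\otimes\cdots\otimes\overline{h_n})\cdot\overline{h_n}^{\,-1}\cdots\overline{h_1}^{\,-1}$. For $x\in Z(G)$ and $n\ge0$ define $$\nu^n_{G,x,\alpha}:C^n(G,k\bar x)\to C^n(k_\alpha G,k_\alpha G),\qquad \nu^n_{G,x,\alpha}(\psi)(\overline{g_1}\otimes\cdots\otimes\overline{g_n})=\psi(g_1,\dots,g_n)\cdot\overline{g_1}\cdots\overline{g_n},$$ where $k\bar x\subseteq k_\alpha G$, extended $k$-linearly. Then: a) For every $x\in G$, the maps $\pi^n_{G,x,\alpha}$ ($n\ge 0$) form a cochain map, and so induce well-defined maps $\pi^{n}_{G,x,\alpha}:\operatorname{HH}^n(k_\alpha G)\to \operatorname{H}^n(C_G(x),k\bar x)$. b) For every $x\in Z(G)$, the maps $\nu^n_{G,x,\alpha}$ ($n\ge 0$) form a cochain map, and so induce well-defined maps $\nu^{n}_{G,x,\alpha}:\operatorname{H}^n(G,k\bar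 x)\to\operatorname{HH}^n(k_\alpha G)$. c) For every $n\ge0$, the map $$\bigoplus_{x\in Z(G)}\nu^n_{G,x,\alpha}:\bigoplus_{x\in Z(G)}\operatorname{H}^n(G,k\bar x)\to\operatorname{HH}^n(k_\alpha G)$$ is injective, and the map $$\bigoplus_{x\in Z(G)}\pi^n_{G,x,\alpha}:\operatorname{HH}^n(k_\alpha G)\to\bigoplus_{x\in Z(G)}\operatorname{H}^n(G,k\bar x)$$ is surjective and a left inverse of it. d) If $G$ is abelian, then for every $n\ge 0$ the map $$\bigoplus_{x\in G}\nu^n_{G,x,\alpha}:\bigoplus_{x\in G}\operatorname{H}^n(G,k\bar x)\to\operatorname{HH}^n(k_\alpha G)$$ is an isomorphism of $k$-vector spaces. -/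

import Mathlib

open CategoryTheory
open scoped DirectSum

universe u

noncomputable section

/-! ### The Hochschild cochain complex of an algebra with coefficients in itself -/

section Hochschild

variable (k : Type u) [CommRing k] (A : Type u) [Ring A] [Algebra k A]

/-- `Cⁿ(A, A) = Hom_k(A^{⊗ n}, A)`: the `k`-multilinear maps in `n` arguments; `C⁰(A, A) = A`. -/
abbrev HochschildCochain (n : ℕ) : Type u :=
  MultilinearMap k (fun _ : Fin n => A) A

variable {A}

/-- The arguments of the `j`-th face, `0 ≤ j ≤ n + 1`, of a cochain of degree `n`:
`(a₁, …, aₙ₊₁) ↦ (a₁, …, aⱼ aⱼ₊₁, …, aₙ₊₁)` for `1 ≤ j ≤ n`, while `a₁` is dropped for `j = 0`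
and `aₙ₊₁` is dropped for `j = n + 1`. -/
def hochschildFaceArgs {n : ℕ} (j : ℕ) (a : Fin (n + 1) → A) : Fin n → A := fun i =>
  if (i : ℕ) + 1 < j then a i.castSucc
  else if (i : ℕ) + 1 = j then a i.castSucc * a i.succ
  else a i.succ

/-- The value of the `j`-th face of a cochain: `d₀ φ (a₁, …, aₙ₊₁) = a₁ φ(a₂, …, aₙ₊₁)`,
`dⱼ φ (a₁, …, aₙ₊₁) = φ(a₁, …, aⱼ aⱼ₊₁, …, aₙ₊₁)` for `1 ≤ j ≤ n`, and
`dₙ₊₁ φ (a₁, …, aₙ₊₁) = φ(a₁, …, aₙ) aₙ₊₁`. -/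
def hochschildFaceFun {n : ℕ} (j : ℕ) (φ : (Fin n → A) → A) (a : Fin (n + 1) → A) : A :=
  (if j = 0 then a 0 else 1) * φ (hochschildFaceArgs j a) *
    (if j = n + 1 then a (Fin.last n) else 1)

variable {k}

theorem hochschildFaceFun_update {n : ℕ} (j : Fin (n + 2)) (φ : HochschildCochain k A n)
    (a : Fin (n + 1) → A) (i : Fin (n + 1)) :
    ∃ T : A →ₗ[k] A, ∀ x, hochschildFaceFun j φ (Function.update a i x) = T x := by
  have hj := j.2
  have hi := i.2
  by_cases hij : (i : ℕ) < j
  · by_cases hin : (i : ℕ) < n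
    · -- the slot `i`
      refine ⟨LinearMap.mulRight k (if (j : ℕ) = n + 1 then a (Fin.last n) else 1) ∘ₗ
        φ.toLinearMap (hochschildFaceArgs j a) ⟨i, hin⟩ ∘ₗ
        LinearMap.mulRight k (if (i : ℕ) + 1 < j then 1 else a (Fin.succ ⟨i, hin⟩)), fun x => ?_⟩
      have h1 : hochschildFaceArgs j (Function.update a i x) =
          Function.update (hochschildFaceArgs j a) ⟨i, hin⟩
            (x * (if (i : ℕ) + 1 < j then 1 else a (Fin.succ ⟨i, hin⟩))) := by
        funext p
        simp only [hochschildFaceArgs, Function.update_apply, Fin.ext_iff, Fin.val_castSucc,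
          Fin.val_succ, Fin.succ_mk]
        split_ifs <;> first | omega | simp_all
        have hp : p.succ = (⟨j, by omega⟩ : Fin (n + 1)) := by ext; simp; omega
        rw [hp]
      have h0 : (j : ℕ) ≠ 0 := by omega
      have h2 : Function.update a i x (Fin.last n) = a (Fin.last n) := by
        rw [Function.update_of_ne]
        intro h; rw [← h] at hin; simp at hin
      simp [hochschildFaceFun, h0, h1, h2]
    · -- the last slot
      have hjn : (j : ℕ) = n + 1 := by omega
      have hi' : i = Fin.last n := by ext; simp; omega
      refine ⟨LinearMap.mulLeft k (φ (hochschildFaceArgs j a)), fun x => ?_⟩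
      have h1 : hochschildFaceArgs j (Function.update a i x) = hochschildFaceArgs j a := by
        funext p
        have hp := p.2
        simp only [hochschildFaceArgs, Function.update_apply, Fin.ext_iff, Fin.val_castSucc,
          Fin.val_succ]
        split_ifs <;> first | omega | rfl
      rw [hochschildFaceFun, h1]
      simp [hjn, hi']
  · by_cases hi0 : (i : ℕ) = 0
    · -- the first slot
      have hj0 : (j : ℕ) = 0 := by omega
      have hi' : i = 0 := by ext; simpa using hi0
      refine ⟨LinearMap.mulRight k (φ (hochschildFaceArgs j a)), fun x => ?_⟩
      have h1 : hochschildFaceArgs j (Function.update a i x) = hochschildFaceArgs j a := by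
        funext p
        have hp := p.2
        simp only [hochschildFaceArgs, Function.update_apply, Fin.ext_iff, Fin.val_castSucc,
          Fin.val_succ]
        split_ifs <;> first | omega | rfl
      rw [hochschildFaceFun, h1]
      simp [hj0, hi']
    · -- the slot `i - 1`
      have hq : (i : ℕ) - 1 < n := by omega
      refine ⟨LinearMap.mulLeft k (if (j : ℕ) = 0 then a 0 else 1) ∘ₗ
        φ.toLinearMap (hochschildFaceArgs j a) ⟨i - 1, hq⟩ ∘ₗ
        LinearMap.mulLeft k (if (i : ℕ) = j then a (Fin.castSucc ⟨i - 1, hq⟩) else 1),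
        fun x => ?_⟩
      have h1 : hochschildFaceArgs j (Function.update a i x) =
          Function.update (hochschildFaceArgs j a) ⟨i - 1, hq⟩
            ((if (i : ℕ) = j then a (Fin.castSucc ⟨i - 1, hq⟩) else 1) * x) := by
        funext p
        simp only [hochschildFaceArgs, Function.update_apply, Fin.ext_iff, Fin.val_castSucc,
          Fin.val_succ, Fin.castSucc_mk]
        split_ifs <;> first | omega | simp_all
        have hp : p.castSucc = (⟨(j : ℕ) - 1, by omega⟩ : Fin (n + 1)) := by ext; simp; omega
        rw [hp]
      have h0 : (j : ℕ) ≠ n + 1 := by omega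
      have h2 : Function.update a i x 0 = a 0 := by
        rw [Function.update_of_ne]
        intro h; rw [← h] at hi0; simp at hi0
      simp [hochschildFaceFun, h0, h1, h2]

/-- The `j`-th face `dⱼ : Cⁿ(A, A) → Cⁿ⁺¹(A, A)`, `0 ≤ j ≤ n + 1`. -/
def hochschildFace (n : ℕ) (j : Fin (n + 2)) :
    HochschildCochain k A n →ₗ[k] HochschildCochain k A (n + 1) where
  toFun φ :=
    { toFun := hochschildFaceFun j φ
      map_update_add' := fun {inst} a i x y => by
        obtain rfl : inst = instDecidableEqFin (n + 1) := Subsingleton.elim _ _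
        obtain ⟨T, hT⟩ := hochschildFaceFun_update j φ a i
        simp only [hT, map_add]
      map_update_smul' := fun {inst} a i c x => by
        obtain rfl : inst = instDecidableEqFin (n + 1) := Subsingleton.elim _ _
        obtain ⟨T, hT⟩ := hochschildFaceFun_update j φ a i
        simp only [hT, map_smul] }
  map_add' φ ψ := by
    ext a
    simp only [hochschildFaceFun, MultilinearMap.coe_mk, add_apply, mul_add,
      add_mul]
  map_smul' c φ := by
    ext a
    simp [hochschildFaceFun]

/-- The Hochschild differential `δⁿ = ∑_{j = 0}^{n + 1} (-1)ʲ dⱼ`. -/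
def hochschildDifferential (n : ℕ) :
    HochschildCochain k A n →ₗ[k] HochschildCochain k A (n + 1) :=
  ∑ j : Fin (n + 2), (-1 : k) ^ (j : ℕ) • hochschildFace n j

theorem hochschildFaceFun_comp {n : ℕ} (φ : (Fin n → A) → A) {i j : ℕ} (hij : i < j)
    (hj : j ≤ n + 2) :
    hochschildFaceFun j (hochschildFaceFun i φ) =
      hochschildFaceFun i (hochschildFaceFun (j - 1) φ) := by
  funext a
  have h1 : hochschildFaceArgs i (hochschildFaceArgs j a) =
      hochschildFaceArgs (j - 1) (hochschildFaceArgs i a) := by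
    funext p
    have hp := p.2
    simp only [hochschildFaceArgs, Fin.val_castSucc, Fin.val_succ, Fin.succ_castSucc]
    split_ifs <;> first | omega | rfl | (rw [mul_assoc])
  have h2 : (if j = 0 then a 0 else 1) * (if i = 0 then hochschildFaceArgs j a 0 else 1) =
      (if i = 0 then a 0 else 1) * (if j - 1 = 0 then hochschildFaceArgs i a 0 else 1) := by
    have e : (Fin.succ 0 : Fin (n + 2)) = 1 := rfl
    simp only [hochschildFaceArgs, Fin.val_zero, Fin.castSucc_zero, e]
    split_ifs <;> first | omega | simp
  have h3 : (if i = n + 1 then hochschildFaceArgs j a (Fin.last n) else 1) *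
        (if j = n + 1 + 1 then a (Fin.last (n + 1)) else 1) =
      (if j - 1 = n + 1 then hochschildFaceArgs i a (Fin.last n) else 1) *
        (if i = n + 1 + 1 then a (Fin.last (n + 1)) else 1) := by
    simp only [hochschildFaceArgs, Fin.val_last, Fin.succ_last]
    split_ifs <;> first | omega | simp
  simp only [hochschildFaceFun]
  rw [h1]
  generalize φ (hochschildFaceArgs (j - 1) (hochschildFaceArgs i a)) = z
  calc _ = ((if j = 0 then a 0 else 1) * (if i = 0 then hochschildFaceArgs j a 0 else 1)) * z *
        ((if i = n + 1 then hochschildFaceArgs j a (Fin.last n) else 1) *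
          (if j = n + 1 + 1 then a (Fin.last (n + 1)) else 1)) := by
        simp only [mul_assoc]
    _ = _ := by rw [h2, h3]; simp only [mul_assoc]

theorem hochschildFace_comp {n : ℕ} (φ : HochschildCochain k A n) (i : Fin (n + 2))
    (j : Fin (n + 3)) (hij : (j : ℕ) ≤ i) :
    hochschildFace (n + 1) i.succ (hochschildFace n ⟨j, by omega⟩ φ) =
      hochschildFace (n + 1) j (hochschildFace n i φ) := by
  ext a
  have := congrFun (hochschildFaceFun_comp (n := n) φ (i := j) (j := i + 1) (by omega)
    (by omega)) a
  simpa [hochschildFace] using this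

theorem hochschildDifferential_comp (n : ℕ) :
    hochschildDifferential (k := k) (A := A) (n + 1) ∘ₗ hochschildDifferential n = 0 := by
  ext1 φ
  simp only [hochschildDifferential, LinearMap.comp_apply, LinearMap.sum_apply,
    LinearMap.smul_apply, map_sum, map_smul, LinearMap.zero_apply, Finset.smul_sum, smul_smul]
  rw [← Finset.sum_product', Finset.univ_product_univ]
  let S : Finset (Fin (n + 2) × Fin (n + 3)) := {p | (p.2 : ℕ) ≤ (p.1 : ℕ)}
  rw [← Finset.sum_add_sum_compl S, ← eq_neg_iff_add_eq_zero, ← Finset.sum_neg_distrib]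
  refine Finset.sum_bij'
    (fun p hp => (⟨p.2, by have := (Finset.mem_filter.mp hp).2; omega⟩, p.1.succ))
    (fun p hp => (⟨(p.2 : ℕ) - 1, by omega⟩, p.1.castSucc)) ?_ ?_ ?_ ?_ ?_
  · rintro ⟨i, j⟩ hp
    simp only [S, Finset.mem_filter, Finset.mem_compl, Finset.mem_univ, true_and] at hp ⊢
    simp; omega
  · rintro ⟨i, j⟩ hp
    simp only [S, Finset.mem_filter, Finset.mem_compl, Finset.mem_univ, true_and] at hp ⊢
    simp; omega
  · rintro ⟨i, j⟩ hp
    simp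
  · rintro ⟨i, j⟩ hp
    simp only [S, Finset.mem_filter, Finset.mem_compl, Finset.mem_univ, true_and] at hp
    simp [Fin.ext_iff]; omega
  · rintro ⟨i, j⟩ hp
    have hij : (j : ℕ) ≤ i := (Finset.mem_filter.mp hp).2
    simp only
    rw [hochschildFace_comp φ i j hij, ← neg_smul]
    congr 1
    simp [pow_succ]
    ring

variable (k A)

/-- The Hochschild cochain complex `C^*(A, A)`. -/
def hochschildComplex : CochainComplex (ModuleCat.{u} k) ℕ :=
  CochainComplex.of (fun n => ModuleCat.of k (HochschildCochain k A n))
    (fun n => ModuleCat.ofHom (hochschildDifferential n)) fun n => by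
    rw [← ModuleCat.ofHom_comp, hochschildDifferential_comp]
    rfl

/-- The Hochschild cohomology `HHⁿ(A) = HHⁿ(A, A)`. -/
def hochschildCohomology (n : ℕ) : ModuleCat.{u} k :=
  (hochschildComplex k A).homology n

end Hochschild

/-! ### Twisted group algebras -/

section Twisted

/-- `2`-cocycles of `G` with values in the trivial `G`-module `kˣ`. -/
structure TwoCocycle (G k : Type u) [Group G] [CommRing k] where
  /-- The function underlying a `2`-cocycle. -/
  toFun : G → G → kˣ
  cocycle : ∀ x y z : G, toFun x (y * z) * toFun y z = toFun (x * y) z * toFun x y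

instance (G k : Type u) [Group G] [CommRing k] : CoeFun (TwoCocycle G k) fun _ => G → G → kˣ :=
  ⟨TwoCocycle.toFun⟩

variable {G k : Type u} [Group G] [CommRing k] (α : TwoCocycle G k)

theorem TwoCocycle.map_one_left (x : G) : α 1 x = α 1 1 := by
  have := α.cocycle 1 1 x
  simp only [one_mul] at this
  exact mul_left_cancel this

theorem TwoCocycle.map_one_right (x : G) : α x 1 = α 1 1 := by
  have := α.cocycle x 1 1
  simp only [mul_one] at this
  exact (mul_left_cancel this).symm

theorem TwoCocycle.map_inv (x : G) : α x⁻¹ x = α x x⁻¹ := by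
  have := α.cocycle x x⁻¹ x
  simp only [inv_mul_cancel, mul_inv_cancel, α.map_one_left, α.map_one_right] at this
  exact mul_left_cancel this

theorem TwoCocycle.barFactor_mul {g h x : G} (hg : g * x = x * g) (hh : h * x = x * h) :
    α (g * h) x * (α x (g * h))⁻¹ = (α g x * (α x g)⁻¹) * (α h x * (α x h)⁻¹) := by
  have e1 := α.cocycle g h x
  have e2 := α.cocycle g x h
  have e3 := α.cocycle x g h
  rw [hh] at e1
  rw [hg] at e2
  rw [← div_eq_mul_inv, ← div_eq_mul_inv, ← div_eq_mul_inv, div_mul_div_comm, div_eq_div_iff_mul_eq_mul]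
  apply mul_right_cancel (b := α g h * α g (x * h))
  calc _ = (α (g * h) x * α g h) * (α g (x * h) * α x h) * α x g := by
        simp only [mul_assoc, mul_left_comm, mul_comm]
    _ = (α g (x * h) * α h x) * (α (x * g) h * α x g) * α g x := by
        rw [← e1, e2]; simp only [mul_assoc, mul_left_comm, mul_comm]
    _ = _ := by
        rw [← e3]; simp only [mul_assoc, mul_left_comm, mul_comm]

/-- The underlying module of the twisted group algebra `k_α G`: the free `k`-module on the basis
`ḡ`, `g ∈ G`. -/
def TwistedGroupAlgebra (_α : TwoCocycle G k) : Type u := G →₀ k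

namespace TwistedGroupAlgebra

instance : AddCommGroup (TwistedGroupAlgebra α) := inferInstanceAs (AddCommGroup (G →₀ k))

instance : Module k (TwistedGroupAlgebra α) := inferInstanceAs (Module k (G →₀ k))

/-- The basis `ḡ`, `g ∈ G`, of `k_α G`. -/
def basis : Module.Basis G k (TwistedGroupAlgebra α) := ⟨LinearEquiv.refl k (G →₀ k)⟩

/-- The basis element `ḡ` of `k_α G`. -/
abbrev bar (g : G) : TwistedGroupAlgebra α := basis α g

/-- The multiplication of `k_α G`, the `k`-bilinear map with `ḡ · h̄ = α(g, h) \overline{gh}`. -/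
def mulMap : TwistedGroupAlgebra α →ₗ[k] TwistedGroupAlgebra α →ₗ[k] TwistedGroupAlgebra α :=
  (basis α).constr k fun g => (basis α).constr k fun h => (α g h : k) • bar α (g * h)

theorem mulMap_bar (g h : G) :
    mulMap α (bar α g) (bar α h) = (α g h : k) • bar α (g * h) := by
  simp [mulMap, Module.Basis.constr_basis]

instance : Mul (TwistedGroupAlgebra α) := ⟨fun a b => mulMap α a b⟩

/-- The unit of `k_α G` is `α(1, 1)⁻¹ 1̄`, hence `1̄` when `α` is normalised. -/
instance : One (TwistedGroupAlgebra α) := ⟨((α 1 1)⁻¹ : kˣ) • bar α 1⟩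

theorem mul_def (a b : TwistedGroupAlgebra α) : a * b = mulMap α a b := rfl

theorem one_def : (1 : TwistedGroupAlgebra α) = (((α 1 1)⁻¹ : kˣ) : k) • bar α 1 := rfl

theorem bar_mul_bar (g h : G) : bar α g * bar α h = (α g h : k) • bar α (g * h) :=
  mulMap_bar α g h

theorem one_mul' (a : TwistedGroupAlgebra α) : 1 * a = a := by
  have : mulMap α 1 = LinearMap.id := (basis α).ext fun g => by
    rw [one_def, map_smul, LinearMap.smul_apply, mulMap_bar, smul_smul, α.map_one_left g]
    simp
  rw [mul_def, this, LinearMap.id_apply]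

theorem mul_one' (a : TwistedGroupAlgebra α) : a * 1 = a := by
  have : (mulMap α).flip 1 = LinearMap.id := (basis α).ext fun g => by
    rw [LinearMap.flip_apply, one_def, map_smul, mulMap_bar, smul_smul, α.map_one_right g]
    simp
  rw [mul_def, ← LinearMap.flip_apply, this, LinearMap.id_apply]

theorem mul_assoc' (a b c : TwistedGroupAlgebra α) : a * b * c = a * (b * c) := by
  have h1 (g h : G) : mulMap α (mulMap α (bar α g) (bar α h)) =
      mulMap α (bar α g) ∘ₗ mulMap α (bar α h) := (basis α).ext fun l => by
    simp only [LinearMap.comp_apply, mulMap_bar, map_smul, LinearMap.smul_apply, smul_smul,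
      ← Units.val_mul, mul_assoc g h l]
    rw [mul_comm (α g h), ← α.cocycle g h l, mul_comm (α g (h * l))]
  have h2 (g : G) (c : TwistedGroupAlgebra α) : (mulMap α).flip c ∘ₗ mulMap α (bar α g) =
      mulMap α (bar α g) ∘ₗ (mulMap α).flip c := (basis α).ext fun h => by
    simpa using LinearMap.congr_fun (h1 g h) c
  have h3 : (mulMap α).flip c ∘ₗ (mulMap α).flip b = (mulMap α).flip (mulMap α b c) :=
    (basis α).ext fun g => by
      simpa using LinearMap.congr_fun (h2 g c) b
  simpa [mul_def] using LinearMap.congr_fun h3 a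

instance : Ring (TwistedGroupAlgebra α) :=
  { (inferInstance : AddCommGroup (TwistedGroupAlgebra α)),
    (inferInstance : Mul (TwistedGroupAlgebra α)),
    (inferInstance : One (TwistedGroupAlgebra α)) with
    one_mul := one_mul' α
    mul_one := mul_one' α
    mul_assoc := mul_assoc' α
    left_distrib := fun a b c => by simp only [mul_def, map_add]
    right_distrib := fun a b c => by simp only [mul_def, map_add, LinearMap.add_apply]
    zero_mul := fun a => by simp only [mul_def, map_zero, LinearMap.zero_apply]
    mul_zero := fun a => by simp only [mul_def, map_zero] }

instance : Algebra k (TwistedGroupAlgebra α) :=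
  Algebra.ofModule (fun c a b => by simp only [mul_def, map_smul, LinearMap.smul_apply])
    (fun c a b => by simp only [mul_def, map_smul])

/-- The basis element `ḡ` as a unit of `k_α G`. -/
def barUnit (g : G) : (TwistedGroupAlgebra α)ˣ where
  val := bar α g
  inv := (((α 1 1)⁻¹ * (α g g⁻¹)⁻¹ : kˣ) : k) • bar α g⁻¹
  val_inv := by
    rw [mul_smul_comm, bar_mul_bar, smul_smul, one_def]
    simp
  inv_val := by
    rw [smul_mul_assoc, bar_mul_bar, smul_smul, one_def, α.map_inv]
    simp

end TwistedGroupAlgebra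

open TwistedGroupAlgebra

/-- The `k C_G(x)`-module `k x̄`: the free `k`-module of rank one on `x̄` (an element `c x̄` is
recorded by its coordinate `c`), with `h x̄ = α(h, x) α(x, h)⁻¹ x̄` for `h ∈ C_G(x)`. -/
def barModule (x : G) : Rep.{u} k (Subgroup.centralizer {x}) :=
  Rep.of (X := k)
    { toFun := fun h => ((α h x * (α x h)⁻¹ : kˣ) : k) • LinearMap.id
      map_one' := by
        simp [α.map_one_left x, α.map_one_right x, Module.End.one_eq_id]
      map_mul' := fun g h => by
        ext
        simp [α.barFactor_mul (x := x) (Subgroup.mem_centralizer_singleton_iff.1 g.2)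
          (Subgroup.mem_centralizer_singleton_iff.1 h.2)]
        ring }

/-- For central `x`, the identification of `G` with `C_G(x)`. -/
def toCentralizer (x : Subgroup.center G) : G →* Subgroup.centralizer {(x : G)} :=
  (MonoidHom.id G).codRestrict _ fun g =>
    Subgroup.mem_centralizer_singleton_iff.2 (Subgroup.mem_center_iff.1 x.2 g)

/-- For central `x`, the module `k x̄` as a `k G`-module, through the identification of `G` with
`C_G(x)`. -/
abbrev centralBarModule (x : Subgroup.center G) : Rep.{u} k G :=
  Rep.res (toCentralizer x) (barModule α x)

/-- The map `πⁿ_{G,x,α} : Cⁿ(k_α G, k_α G) → Cⁿ(C_G(x), k x̄)`: the value of `πⁿ(φ)` at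
`(h₁, …, hₙ)` is `a x̄`, where `a` is the coefficient of `x̄` in
`φ(h̄₁, …, h̄ₙ) · h̄ₙ⁻¹ ⋯ h̄₁⁻¹ = φ(h̄₁, …, h̄ₙ) · (h̄₁ ⋯ h̄ₙ)⁻¹`. -/
def piCochain (x : G) (n : ℕ) :
    HochschildCochain k (TwistedGroupAlgebra α) n →ₗ[k]
      ((Fin n → Subgroup.centralizer {x}) → k) where
  toFun φ h := (basis α).coord x
    (φ (fun i => bar α (h i)) * ↑((List.ofFn fun i => barUnit α (h i)).prod)⁻¹)
  map_add' φ ψ := by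
    funext h
    simp [add_mul]
  map_smul' c φ := by
    funext h
    simp

/-- The map `νⁿ_{G,x,α} : Cⁿ(G, k x̄) → Cⁿ(k_α G, k_α G)` for central `x`: `νⁿ(ψ)` is the
`k`-multilinear map with `νⁿ(ψ)(ḡ₁, …, ḡₙ) = ψ(g₁, …, gₙ) · ḡ₁ ⋯ ḡₙ`, where
`ψ(g₁, …, gₙ) ∈ k x̄ ⊆ k_α G`; this formula on basis elements is `nuCochain_bar` below. -/
def nuCochain [Finite G] (x : Subgroup.center G) (n : ℕ) :
    ((Fin n → G) → k) →ₗ[k] HochschildCochain k (TwistedGroupAlgebra α) n :=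
  letI := Fintype.ofFinite G
  ∑ g : Fin n → G, (LinearMap.proj g).smulRight
    (((MultilinearMap.mkPiAlgebra k (Fin n) k).compLinearMap
      fun i => (basis α).coord (g i)).smulRight
        (bar α x * (List.ofFn fun i => bar α (g i)).prod))

theorem nuCochain_bar [Finite G] (x : Subgroup.center G) (n : ℕ) (ψ : (Fin n → G) → k)
    (g : Fin n → G) :
    nuCochain α x n ψ (fun i => bar α (g i)) =
      (ψ g • bar α (x : G)) * (List.ofFn fun i => bar α (g i)).prod := by
  classical
  let _ := Fintype.ofFinite G
  rw [nuCochain, LinearMap.sum_apply, sum_apply, Finset.sum_eq_single g]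
  · simp
  · intro h _ hne
    obtain ⟨i, hi⟩ := Function.ne_iff.1 hne
    have : ∏ i, ((basis α).coord (h i)) (bar α (g i)) = 0 :=
      Finset.prod_eq_zero (Finset.mem_univ i) (by simp [hi])
    simp only [Module.Basis.coord_apply] at this
    simp [-Module.Basis.repr_self, this]
  · simp

end Twisted

/-! ### Direct sums of linear maps -/

section DirectSum

variable {k : Type*} [CommRing k] {ι : Type*} {M : ι → Type*} [∀ i, AddCommGroup (M i)]
  [∀ i, Module k (M i)] {V : Type*} [AddCommGroup V] [Module k V]

open Classical in
/-- The map `⨁ Mᵢ → V` with components `Mᵢ → V`. -/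
def directSumDesc (f : ∀ i, M i →ₗ[k] V) : (⨁ i, M i) →ₗ[k] V :=
  DirectSum.toModule k ι V f

/-- The map `V → ⨁ Mᵢ` with components `V → Mᵢ`, for a finite index set. -/
def directSumLift [Finite ι] (f : ∀ i, V →ₗ[k] M i) : V →ₗ[k] ⨁ i, M i :=
  letI := Fintype.ofFinite ι
  (DirectSum.linearEquivFunOnFintype k ι M).symm.toLinearMap ∘ₗ LinearMap.pi f

end DirectSum

end

/-! Sending a Hochschild cochain `φ` to `(g₁, …, gₙ) ↦ φ(ḡ₁, …, ḡₙ)(ḡ₁ ⋯ ḡₙ)⁻¹`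
(`normalizedCochain`) loses nothing, because the `ḡ` form a basis of units. It turns `δ` into the
group cohomology differential for `G` acting on `k_α G` by conjugation with the `ḡ`
(`normalizedCochain_differential`). Merging two neighbouring arguments produces the same value of
`α` in `φ` and in the product `ḡ₁ ⋯ ḡₙ`, so the cocycle cancels and survives only in the action.

Conjugation by `h̄` permutes the lines `k x̄` according to `x ↦ h x h⁻¹`. Hence the coefficient of
`x̄` is equivariant for `C_G(x)` (`coord_conj`), and `π` is restriction to `C_G(x)` followed by this
coefficient map. For central `x` the line `k x̄` is a `G`-summand of `k_α G`, and `ν` is induced by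
its inclusion.

So `π_y ∘ ν_x` is the identity for `x = y` and zero otherwise, already on cochains. When `G` is
abelian the lines `k x̄` exhaust `k_α G` as a `G`-module, and `∑ ν_x ∘ π_x` is the identity on
cochains. Functoriality and additivity of homology give the rest. -/

/-! ### Direct sums of maps with orthogonal or complete families of one-sided inverses. -/

section DirectSum

variable {k : Type*} [CommRing k] {ι : Type*} {M : ι → Type*} [∀ i, AddCommGroup (M i)]
  [∀ i, Module k (M i)] {V : Type*} [AddCommGroup V] [Module k V]

theorem directSumLift_apply [Finite ι] (p : ∀ i, V →ₗ[k] M i) (v : V) (i : ι) :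
    directSumLift p v i = p i v := by
  let _ := Fintype.ofFinite ι
  exact congrFun (LinearEquiv.apply_symm_apply (DirectSum.linearEquivFunOnFintype k ι M)
    (fun i => p i v)) i

open Classical in
theorem directSumDesc_lof (f : ∀ i, M i →ₗ[k] V) (i : ι) (m : M i) :
    directSumDesc f (DirectSum.lof k ι M i m) = f i m := by
  exact DirectSum.toModule_lof k i m

theorem directSumLift_comp_directSumDesc [Finite ι] (f : ∀ i, M i →ₗ[k] V)
    (p : ∀ i, V →ₗ[k] M i) (h1 : ∀ i, p i ∘ₗ f i = LinearMap.id)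
    (h0 : ∀ i j, i ≠ j → p j ∘ₗ f i = 0) :
    directSumLift p ∘ₗ directSumDesc f = LinearMap.id := by
  classical
  refine DirectSum.linearMap_ext k fun i => LinearMap.ext fun m => DFinsupp.ext fun j => ?_
  rw [LinearMap.comp_apply, LinearMap.comp_apply, directSumDesc_lof]
  refine (directSumLift_apply p _ j).trans ?_
  rw [LinearMap.comp_apply, LinearMap.id_apply]
  obtain rfl | hij := eq_or_ne i j
  · exact (LinearMap.congr_fun (h1 i) m).trans (DirectSum.lof_apply k i m).symm
  · exact (LinearMap.congr_fun (h0 i j hij) m).trans (DirectSum.of_eq_of_ne i j m hij.symm).symm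

theorem directSumDesc_surjective [Fintype ι] (f : ∀ i, M i →ₗ[k] V)
    (p : ∀ i, V →ₗ[k] M i) (h : ∑ i, f i ∘ₗ p i = LinearMap.id) :
    Function.Surjective (directSumDesc f) := by
  classical
  intro v
  refine ⟨∑ i, DirectSum.lof k ι M i (p i v), ?_⟩
  simp only [map_sum, directSumDesc_lof]
  simpa using LinearMap.congr_fun h v

end DirectSum

/-! ### Hochschild faces in terms of `Fin.contractNth`, the operation in the group cohomology
differential. -/

section Faces

theorem hochschildFaceArgs_succ {A : Type u} [Ring A] {n : ℕ} (j : Fin (n + 1))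
    (a : Fin (n + 1) → A) :
    hochschildFaceArgs ((j : ℕ) + 1) a = j.contractNth (· * ·) a := by
  funext i
  simp [hochschildFaceArgs, Fin.contractNth]

theorem Fin.contractNth_last {X : Type*} (op : X → X → X) {n : ℕ} (a : Fin (n + 1) → X) :
    (Fin.last n).contractNth op a = fun i => a i.castSucc := by
  funext i
  simp [Fin.contractNth]

/-- Contraction omits one entry from the sequence of partial products. As `j.castSucc` is not the
last index, the omitted entry is not the total product. -/
theorem Fin.prod_ofFn_contractNth {M : Type*} [Monoid M] {n : ℕ} (j : Fin n)
    (a : Fin (n + 1) → M) :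
    (List.ofFn (j.castSucc.contractNth (· * ·) a)).prod = (List.ofFn a).prod := by
  have key (m : ℕ) (b : Fin m → M) : (List.ofFn b).prod = Fin.partialProd b (Fin.last m) := by
    simp [Fin.partialProd, List.take_of_length_le]
  rw [key, key, Fin.partialProd_contractNth, Function.comp_apply]
  congr 1
  rw [Fin.succAbove_of_le_castSucc _ _ (by simp [Fin.le_def]), Fin.succ_last]

/-- Face `0` is set apart because it alone becomes the action term of group cohomology; the
remaining faces, the outer one included, become contractions. -/
theorem hochschildDifferential_apply {k A : Type u} [CommRing k] [Ring A] [Algebra k A] {n : ℕ}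
    (φ : HochschildCochain k A n) (a : Fin (n + 1) → A) :
    hochschildDifferential n φ a =
      hochschildFaceFun 0 φ a +
        ∑ j : Fin (n + 1), (-1 : k) ^ ((j : ℕ) + 1) • hochschildFaceFun ((j : ℕ) + 1) φ a := by
  rw [hochschildDifferential, LinearMap.sum_apply, sum_apply, Fin.sum_univ_succ]
  simp [hochschildFace]

end Faces

/-! ### Normalised cochains and the conjugation action on the twisted group algebra. -/

section Twisted

open TwistedGroupAlgebra groupCohomology

variable {G k : Type u} [Group G] [CommRing k] (α : TwoCocycle G k)

namespace TwistedGroupAlgebra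

/-- The unit `ḡ₁ ⋯ ḡₙ` of `k_α G`. -/
noncomputable def barProd {n : ℕ} (g : Fin n → G) : (TwistedGroupAlgebra α)ˣ :=
  (List.ofFn fun i => barUnit α (g i)).prod

theorem coe_barProd {n : ℕ} (g : Fin n → G) :
    (barProd α g : TwistedGroupAlgebra α) = (List.ofFn fun i => bar α (g i)).prod := by
  rw [barProd, ← Units.coeHom_apply, map_list_prod, List.map_ofFn]
  rfl

theorem barProd_succ {n : ℕ} (g : Fin (n + 1) → G) :
    barProd α g = barUnit α (g 0) * barProd α fun i => g i.succ := by
  simp [barProd, List.ofFn_succ]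

theorem barProd_castSucc {n : ℕ} (g : Fin (n + 1) → G) :
    barProd α g = (barProd α fun i => g i.castSucc) * barUnit α (g (Fin.last n)) := by
  simp only [barProd, List.ofFn_succ', List.concat_eq_append, List.prod_append,
    List.prod_singleton]

theorem map_contractNth_bar {n : ℕ} (φ : HochschildCochain k (TwistedGroupAlgebra α) n)
    (j : Fin n) (g : Fin (n + 1) → G) :
    φ (j.castSucc.contractNth (· * ·) fun i => bar α (g i)) =
      (α (g j.castSucc) (g j.succ) : k) •
        φ fun i => bar α (j.castSucc.contractNth (· * ·) g i) := by
  -- The two argument tuples differ only in the merged slot, by a scalar that multilinearity pulls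
  -- out.
  have : (j.castSucc.contractNth (· * ·) fun i => bar α (g i)) =
      Function.update (fun i => bar α (j.castSucc.contractNth (· * ·) g i)) j
        ((α (g j.castSucc) (g j.succ) : k) • bar α (j.castSucc.contractNth (· * ·) g j)) := by
    funext i
    obtain rfl | hij := eq_or_ne i j
    · simp [Fin.contractNth, bar_mul_bar]
    · rw [Function.update_of_ne hij]
      have : (i : ℕ) ≠ j := fun h => hij (Fin.ext h)
      simp only [Fin.contractNth, Fin.val_castSucc, this, if_false]
      split_ifs <;> rfl
  rw [this, MultilinearMap.map_update_smul, Function.update_eq_self]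

/-- The product is itself a multilinear cochain, so `map_contractNth_bar` applies to it. The scalar
is therefore the one that appears for an arbitrary `φ`, and the two cancel after normalisation. -/
theorem coe_barProd_eq_smul_contractNth {n : ℕ} (j : Fin n) (g : Fin (n + 1) → G) :
    (barProd α g : TwistedGroupAlgebra α) =
      (α (g j.castSucc) (g j.succ) : k) • (barProd α (j.castSucc.contractNth (· * ·) g)) := by
  have := map_contractNth_bar α (MultilinearMap.mkPiAlgebraFin k n (TwistedGroupAlgebra α)) j g
  simpa only [MultilinearMap.mkPiAlgebraFin_apply, Fin.prod_ofFn_contractNth, ← coe_barProd]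
    using this

/-- The function `(g₁, …, gₙ) ↦ φ(ḡ₁, …, ḡₙ) · (ḡ₁ ⋯ ḡₙ)⁻¹` associated with a cochain `φ`. -/
noncomputable def normalizedCochain {n : ℕ} (φ : HochschildCochain k (TwistedGroupAlgebra α) n)
    (g : Fin n → G) : TwistedGroupAlgebra α :=
  φ (fun i => bar α (g i)) * ↑(barProd α g)⁻¹

theorem normalizedCochain_injective {n : ℕ}
    {φ ψ : HochschildCochain k (TwistedGroupAlgebra α) n}
    (h : ∀ g, normalizedCochain α φ g = normalizedCochain α ψ g) : φ = ψ :=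
  Module.Basis.ext_multilinear (fun _ => basis α) fun g => by
    simpa [normalizedCochain] using h g

/-- Inverting the product moves its first factor `ḡ₁` to the far right, so left multiplication by
`ḡ₁` becomes conjugation. -/
theorem hochschildFaceFun_zero_mul_inv {n : ℕ}
    (φ : HochschildCochain k (TwistedGroupAlgebra α) n) (g : Fin (n + 1) → G) :
    hochschildFaceFun 0 φ (fun i => bar α (g i)) * ↑(barProd α g)⁻¹ =
      bar α (g 0) * normalizedCochain α φ (fun i => g i.succ) * ↑(barUnit α (g 0))⁻¹ := by
  have : hochschildFaceArgs 0 (fun i => bar α (g i)) = fun i : Fin n => bar α (g i.succ) := by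
    funext i
    simp [hochschildFaceArgs]
  simp [hochschildFaceFun, this, normalizedCochain, barProd_succ α g, mul_assoc]

theorem hochschildFaceFun_succ_mul_inv {n : ℕ}
    (φ : HochschildCochain k (TwistedGroupAlgebra α) n) (j : Fin (n + 1)) (g : Fin (n + 1) → G) :
    hochschildFaceFun ((j : ℕ) + 1) φ (fun i => bar α (g i)) * ↑(barProd α g)⁻¹ =
      normalizedCochain α φ (j.contractNth (· * ·) g) := by
  rw [hochschildFaceFun, hochschildFaceArgs_succ, normalizedCochain]
  induction j using Fin.lastCases with
  | last =>
    -- In the outer face the right factor `ḡₙ₊₁` meets its own inverse at the head of the inverted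
    -- product.
    simp only [Fin.contractNth_last, barProd_castSucc α g, Fin.val_last, if_true, mul_inv_rev,
      Units.val_mul]
    have cancel (z : TwistedGroupAlgebra α) :
        bar α (g (Fin.last n)) * (↑(barUnit α (g (Fin.last n)))⁻¹ * z) = z :=
      (barUnit α (g (Fin.last n))).mul_inv_cancel_left z
    simp [mul_assoc, cancel]
  | cast j =>
    have hj : (j : ℕ) ≠ n := j.2.ne
    rw [map_contractNth_bar, Units.mul_inv_eq_iff_eq_mul, coe_barProd_eq_smul_contractNth α j g]
    simp [hj]

theorem normalizedCochain_differential {n : ℕ}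
    (φ : HochschildCochain k (TwistedGroupAlgebra α) n) (g : Fin (n + 1) → G) :
    normalizedCochain α (hochschildDifferential n φ) g =
      bar α (g 0) * normalizedCochain α φ (fun i => g i.succ) * ↑(barUnit α (g 0))⁻¹ +
        ∑ j : Fin (n + 1),
          (-1 : k) ^ ((j : ℕ) + 1) • normalizedCochain α φ (j.contractNth (· * ·) g) := by
  rw [normalizedCochain, hochschildDifferential_apply, add_mul, Finset.sum_mul,
    hochschildFaceFun_zero_mul_inv]
  simp only [smul_mul_assoc, hochschildFaceFun_succ_mul_inv]

/-- Both `h̄ x̄` and the product of `\overline{h x h⁻¹}` with `h̄` are multiples of `\overline{h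
x}`; the scalar is the quotient of the two values of `α`. -/
theorem bar_mul_bar_mul_inv (h x : G) :
    bar α h * bar α x * ↑(barUnit α h)⁻¹ =
      ((α h x * (α (h * x * h⁻¹) h)⁻¹ : kˣ) : k) • bar α (h * x * h⁻¹) := by
  rw [Units.mul_inv_eq_iff_eq_mul, smul_mul_assoc]
  change _ = _ • (bar α _ * bar α h)
  rw [bar_mul_bar, bar_mul_bar, smul_smul]
  simp

theorem bar_mul_bar_mul_inv_of_commute {h x : G} (hx : h * x = x * h) :
    bar α h * bar α x * ↑(barUnit α h)⁻¹ = ((α h x * (α x h)⁻¹ : kˣ) : k) • bar α x := by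
  rw [bar_mul_bar_mul_inv, hx, mul_inv_cancel_right]

theorem coord_conj {h x : G} (hx : h * x = x * h) (z : TwistedGroupAlgebra α) :
    (basis α).coord x (bar α h * z * ↑(barUnit α h)⁻¹) =
      ((α h x * (α x h)⁻¹ : kˣ) : k) * (basis α).coord x z := by
  have : (basis α).coord x ∘ₗ LinearMap.mulRight k (↑(barUnit α h)⁻¹ : TwistedGroupAlgebra α) ∘ₗ
      LinearMap.mulLeft k (bar α h) =
      ((α h x * (α x h)⁻¹ : kˣ) : k) • (basis α).coord x := by
    refine (basis α).ext fun y => ?_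
    simp only [LinearMap.comp_apply, LinearMap.mulLeft_apply, LinearMap.mulRight_apply,
      LinearMap.smul_apply]
    obtain rfl | hy := eq_or_ne y x
    · rw [bar_mul_bar_mul_inv_of_commute α hx, map_smul]
    -- No other line is carried onto `k x̄`: since `h` fixes `x`, `h y h⁻¹ = x` forces `y = x`.
    · have hc : h * y * h⁻¹ ≠ x := fun e => hy <| by
        rw [mul_inv_eq_iff_eq_mul, ← hx] at e
        exact mul_left_cancel e
      rw [bar_mul_bar_mul_inv, map_smul]
      simp [Finsupp.single_eq_of_ne hy.symm, Finsupp.single_eq_of_ne hc.symm]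
  exact LinearMap.congr_fun this z

end TwistedGroupAlgebra

/-! ### Compatibility of `π` and `ν` with the differentials. -/

theorem piCochain_apply (x : G) (n : ℕ) (φ : HochschildCochain k (TwistedGroupAlgebra α) n)
    (h : Fin n → Subgroup.centralizer {x}) :
    piCochain α x n φ h = (basis α).coord x (normalizedCochain α φ fun i => h i) :=
  rfl

theorem normalizedCochain_nuCochain [Finite G] (x : Subgroup.center G) (n : ℕ)
    (ψ : (Fin n → G) → k) (g : Fin n → G) :
    normalizedCochain α (nuCochain α x n ψ) g = ψ g • bar α (x : G) := by
  rw [normalizedCochain, nuCochain_bar, ← coe_barProd, Units.mul_inv_cancel_right]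

theorem piCochain_differential (x : G) (n : ℕ)
    (φ : HochschildCochain k (TwistedGroupAlgebra α) n) :
    piCochain α x (n + 1) (hochschildDifferential n φ) =
      (inhomogeneousCochains.d (barModule α x) n).hom (piCochain α x n φ) := by
  funext h
  rw [piCochain_apply, normalizedCochain_differential, map_add,
    coord_conj α (Subgroup.mem_centralizer_singleton_iff.1 (h 0).2), map_sum]
  refine Eq.trans ?_ (inhomogeneousCochains.d_hom_apply (barModule α x) n _ h).symm
  refine congrArg₂ (· + ·) rfl (Finset.sum_congr rfl fun j _ => ?_)
  rw [map_smul, piCochain_apply]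
  congr 3
  -- Contraction commutes with the inclusion of `C_G(x)` into `G`.
  exact (Fin.comp_contractNth (· * ·) (· * ·) (f := Subtype.val) (fun _ _ => rfl) j h).symm

theorem nuCochain_differential [Finite G] (x : Subgroup.center G) (n : ℕ)
    (ψ : (Fin n → G) → k) :
    nuCochain α x (n + 1) ((inhomogeneousCochains.d (centralBarModule α x) n).hom ψ) =
      hochschildDifferential n (nuCochain α x n ψ) := by
  refine normalizedCochain_injective α fun g => ?_
  rw [normalizedCochain_differential]
  refine (normalizedCochain_nuCochain α x (n + 1) _ g).trans ?_
  simp only [normalizedCochain_nuCochain]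
  rw [mul_smul_comm, smul_mul_assoc,
    bar_mul_bar_mul_inv_of_commute α (Subgroup.mem_center_iff.1 x.2 (g 0))]
  -- Every term is a multiple of `x̄`, so the identity reduces to one between scalars.
  simp only [smul_smul, ← smul_eq_mul (a := (-1 : k) ^ _), ← Finset.sum_smul, ← add_smul]
  congr 1
  refine (inhomogeneousCochains.d_hom_apply (centralBarModule α x) n ψ g).trans ?_
  exact congrArg₂ (· + ·) (mul_comm (_ : k) (_ : k)) rfl

/-! ### Cochain maps and their composites. -/

theorem hochschildComplex_d {A : Type u} [Ring A] [Algebra k A] (n : ℕ) :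
    (hochschildComplex k A).d n (n + 1) = ModuleCat.ofHom (hochschildDifferential n) :=
  CochainComplex.of_d (fun n => ModuleCat.of k (HochschildCochain k A n))
    (fun n => ModuleCat.ofHom (hochschildDifferential n)) n

/-- The cochain map with components `πⁿ_{G,x,α}`. -/
noncomputable def piHom (x : G) : hochschildComplex k (TwistedGroupAlgebra α) ⟶
    groupCohomology.inhomogeneousCochains (barModule α x) :=
  CochainComplex.ofHom (fun n => ModuleCat.ofHom (piCochain α x n)) fun n => by
    rw [hochschildComplex_d, inhomogeneousCochains.d_def]
    exact ModuleCat.hom_ext <| LinearMap.ext fun φ => (piCochain_differential α x n φ).symm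

/-- The cochain map with components `νⁿ_{G,x,α}`, for central `x`. -/
noncomputable def nuHom [Finite G] (x : Subgroup.center G) :
    groupCohomology.inhomogeneousCochains (centralBarModule α x) ⟶
      hochschildComplex k (TwistedGroupAlgebra α) :=
  CochainComplex.ofHom (fun n => ModuleCat.ofHom (nuCochain α x n)) fun n => by
    rw [hochschildComplex_d, inhomogeneousCochains.d_def]
    exact ModuleCat.hom_ext <| LinearMap.ext fun ψ => (nuCochain_differential α x n ψ).symm

/-- For central `x`, the cochain map `π_{G,x,α}` with values in the cochains of `G`. -/
noncomputable def piCentralHom (x : Subgroup.center G) :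
    hochschildComplex k (TwistedGroupAlgebra α) ⟶
      groupCohomology.inhomogeneousCochains (centralBarModule α x) :=
  piHom α x ≫ groupCohomology.cochainsMap (toCentralizer x) (𝟙 (centralBarModule α x))

theorem piCentralHom_f_apply (x : Subgroup.center G) (n : ℕ)
    (φ : HochschildCochain k (TwistedGroupAlgebra α) n) (g : Fin n → G) :
    ((piCentralHom α x).f n).hom φ g = (basis α).coord (x : G) (normalizedCochain α φ g) :=
  rfl

theorem nuHom_comp_piCentralHom [Finite G] (x : Subgroup.center G) :
    nuHom α x ≫ piCentralHom α x = 𝟙 _ := by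
  refine HomologicalComplex.hom_ext _ _ fun n => ModuleCat.hom_ext <| LinearMap.ext
    fun (ψ : (Fin n → G) → k) => funext fun g => ?_
  refine (piCentralHom_f_apply α x n (nuCochain α x n ψ) g).trans ?_
  rw [normalizedCochain_nuCochain]
  simp
  rfl

theorem nuHom_comp_piCentralHom_of_ne [Finite G] {x y : Subgroup.center G} (h : x ≠ y) :
    nuHom α x ≫ piCentralHom α y = 0 := by
  refine HomologicalComplex.hom_ext _ _ fun n => ModuleCat.hom_ext <| LinearMap.ext
    fun (ψ : (Fin n → G) → k) => funext fun g => ?_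
  refine (piCentralHom_f_apply α y n (nuCochain α x n ψ) g).trans ?_
  rw [normalizedCochain_nuCochain]
  simp [Finsupp.single_eq_of_ne (fun e => h (Subtype.ext e.symm) : (y : G) ≠ x)]
  rfl

/-- The section `c` encodes that all of `G` is central. After normalisation the identity is the
expansion of an element of `k_α G` in the basis `x̄`. -/
theorem sum_piCentralHom_comp_nuHom [Fintype G] (c : G → Subgroup.center G)
    (hc : ∀ x, (c x : G) = x) :
    ∑ x, piCentralHom α (c x) ≫ nuHom α (c x) = 𝟙 _ := by
  refine HomologicalComplex.hom_ext _ _ fun n => ModuleCat.hom_ext <| LinearMap.ext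
    fun (φ : HochschildCochain k (TwistedGroupAlgebra α) n) => ?_
  have key : ∑ x, nuCochain α (c x) n
      (fun g => (basis α).coord (c x : G) (normalizedCochain α φ g)) = φ := by
    refine normalizedCochain_injective α fun g => ?_
    rw [normalizedCochain, sum_apply, Finset.sum_mul]
    refine Eq.trans (Finset.sum_congr rfl fun x _ =>
      normalizedCochain_nuCochain α (c x) n _ g) ?_
    simp only [hc]
    exact (basis α).sum_repr _
  refine Eq.trans ?_ key
  -- Taking the component in degree `n` is additive, which turns the sum of cochain maps into a sum
  -- of linear maps.
  have hsum := congrArg ModuleCat.Hom.hom (map_sum (HomologicalComplex.Hom.fAddMonoidHom n)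
    (fun x => piCentralHom α (c x) ≫ nuHom α (c x)) Finset.univ)
  rw [ModuleCat.hom_sum] at hsum
  exact (LinearMap.congr_fun hsum φ).trans (LinearMap.sum_apply _ _ _)

end Twisted

/-! ### Passage to cohomology. -/

theorem mainTheorem5 {k G : Type u} [Field k] [Group G] [Finite G] (α : TwoCocycle G k) :
    ∃ (P : ∀ x : G, hochschildComplex k (TwistedGroupAlgebra α) ⟶
          groupCohomology.inhomogeneousCochains (barModule α x))
      (N : ∀ x : Subgroup.center G,
          groupCohomology.inhomogeneousCochains (centralBarModule α x) ⟶
            hochschildComplex k (TwistedGroupAlgebra α)),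
      (∀ (x : G) (n : ℕ), (P x).f n = ModuleCat.ofHom (piCochain α x n)) ∧
      (∀ (x : Subgroup.center G) (n : ℕ), (N x).f n = ModuleCat.ofHom (nuCochain α x n)) ∧
      ∀ n : ℕ,
        let piStar (x : G) :
            hochschildCohomology k (TwistedGroupAlgebra α) n ⟶
              groupCohomology (barModule α x) n :=
          HomologicalComplex.homologyMap (P x) n
        let nuStar (x : Subgroup.center G) :
            groupCohomology (centralBarModule α x) n ⟶
              hochschildCohomology k (TwistedGroupAlgebra α) n :=
          HomologicalComplex.homologyMap (N x) n
        let piStarCentral (x : Subgroup.center G) :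
            hochschildCohomology k (TwistedGroupAlgebra α) n ⟶
              groupCohomology (centralBarModule α x) n :=
          piStar x ≫ groupCohomology.map (toCentralizer x) (𝟙 (centralBarModule α x)) n
        let sumNu : (⨁ x : Subgroup.center G, groupCohomology (centralBarModule α x) n) →ₗ[k]
            hochschildCohomology k (TwistedGroupAlgebra α) n :=
          directSumDesc fun x => (nuStar x).hom
        let sumPi : hochschildCohomology k (TwistedGroupAlgebra α) n →ₗ[k]
            ⨁ x : Subgroup.center G, groupCohomology (centralBarModule α x) n :=
          directSumLift fun x => (piStarCentral x).hom
        (Function.Injective sumNu ∧ Function.Surjective sumPi ∧ sumPi ∘ₗ sumNu = LinearMap.id) ∧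
        ∀ hG : ∀ g h : G, g * h = h * g,
          let central (x : G) : Subgroup.center G :=
            ⟨x, Subgroup.mem_center_iff.2 fun g => hG g x⟩
          Function.Bijective
            (directSumDesc (M := fun x : G => groupCohomology (centralBarModule α (central x)) n)
              fun x => (nuStar (central x)).hom) := by
  refine ⟨piHom α, nuHom α, fun _ _ => rfl, fun _ _ => rfl, fun n => ?_⟩
  intro piStar nuStar piStarCentral sumNu sumPi
  -- Restricting to `G` after taking cohomology agrees with doing so on cochains, so the cochain
  -- identities apply.
  have hpi (x : Subgroup.center G) :
      piStarCentral x = HomologicalComplex.homologyMap (piCentralHom α x) n :=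
    (HomologicalComplex.homologyMap_comp _ _ n).symm
  have hcomp (x y : Subgroup.center G) : nuStar x ≫ piStarCentral y =
      HomologicalComplex.homologyMap (nuHom α x ≫ piCentralHom α y) n :=
    (congrArg (nuStar x ≫ ·) (hpi y)).trans (HomologicalComplex.homologyMap_comp _ _ n).symm
  have h1 (x : Subgroup.center G) :
      (piStarCentral x).hom ∘ₗ (nuStar x).hom = LinearMap.id := by
    rw [← ModuleCat.hom_comp, hcomp, nuHom_comp_piCentralHom, HomologicalComplex.homologyMap_id]
    rfl
  have h0 (x y : Subgroup.center G) (hxy : x ≠ y) :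
      (piStarCentral y).hom ∘ₗ (nuStar x).hom = 0 := by
    rw [← ModuleCat.hom_comp, hcomp, nuHom_comp_piCentralHom_of_ne α hxy,
      HomologicalComplex.homologyMap_zero]
    rfl
  have hid : sumPi ∘ₗ sumNu = LinearMap.id := directSumLift_comp_directSumDesc _ _ h1 h0
  have hleft : Function.LeftInverse sumPi sumNu := LinearMap.congr_fun hid
  refine ⟨⟨hleft.injective, hleft.surjective, hid⟩, ?_⟩
  intro hG central
  constructor
  · have hid' := directSumLift_comp_directSumDesc
      (fun x => (nuStar (central x)).hom) (fun x => (piStarCentral (central x)).hom)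
      (fun x => h1 _) (fun x y hxy => h0 _ _ fun e => hxy (congrArg Subtype.val e))
    have hleft' : Function.LeftInverse (directSumLift fun x => (piStarCentral (central x)).hom)
        (directSumDesc fun x => (nuStar (central x)).hom) := LinearMap.congr_fun hid'
    exact hleft'.injective
  · let _ := Fintype.ofFinite G
    refine directSumDesc_surjective _ (fun x => (piStarCentral (central x)).hom) ?_
    -- Surjectivity comes from applying the additive functor `Hⁿ` to the decomposition of the
    -- identity cochain map.
    have := congrArg (fun f : hochschildComplex k (TwistedGroupAlgebra α) ⟶ _ =>
      (HomologicalComplex.homologyMap f n).hom)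
      (sum_piCentralHom_comp_nuHom α central fun _ => rfl)
    simp only [HomologicalComplex.homologyMap_id] at this
    refine Eq.trans ?_ this
    refine Eq.trans ?_ (congrArg ModuleCat.Hom.hom ((HomologicalComplex.homologyFunctor
      (ModuleCat k) (ComplexShape.up ℕ) n).map_sum _ _).symm)
    refine Eq.trans (Finset.sum_congr rfl fun x _ => ?_) (ModuleCat.hom_sum _ _).symm
    refine (congrArg ModuleCat.Hom.hom (congrArg (· ≫ nuStar (central x)) (hpi (central x)))).trans ?_
    exact congrArg ModuleCat.Hom.hom (HomologicalComplex.homologyMap_comp _ _ n).symm
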